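/- Types are read as 1-types, i.e. groupoids: identifications are arrows, maps are functors, homotopies are natural isomorphisms, equivalences are equivalences of categories. A pointed map $f:A\to_* B$ is a functor with an arrow $f_\ast:f(\ast_A)\to\ast_B$; it induces $\Omega f:\Omega A\to\Omega B$, $p\mapsto f_\ast^{-1}\cdot f(p)\cdot f_\ast$, on the groups of loops at the base points. A delooping $BG$ of a group $G$ is a pointed connected groupoid with an isomorphism of groups $\Omega BG\cong G$; a delooping $Bf:BG\to_* BH$ of a group morphism $f:G\to H$ is a pointed map such that $\Omega Bf$ corresponds to $f$ under $\Omega BG\cong G$ and $\Omega BH\cong H$. The kernel of a pointed map $f:A\to_*B$ is its homotopy fiber $\ker f=\Sigma(x:A).(f(x)=\ast_B)$, pointed by $(\ast_A,f_\ast)$, with the projection to $A$ as canonical inclusion. A pair of maps $F\xrightarrow{i}E\xrightarrow{f}B$ with $B$ pointed is a fiber sequence if $i$ is the homotopy pullback of $\ast_B:1\to B$ along $f$. Lemma. Let $g:G\to H$ be a morphism of groups, and let $Bg:BG\to_* BH$ be a delooping of $g$ between deloopings of $G$ and $H$. (1) Let $Bi:B(\ker g)\to_* BG$ be a delooping of the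 inclusion $i:\ker g\hookrightarrow G$. Then there is a pointed equivalence between $B(\ker g)$ and the connected component of the base point in $\ker Bg$, under which $Bi$ corresponds to the canonical inclusion into $BG$. Moreover $\ker Bg= B(\ker g)$ with $Bi$ as canonical inclusion (i.e. there is a pointed equivalence $B(\ker g)\simeq\ker Bg$ under which $Bi$ corresponds, as a pointed map, to the canonical inclusion) if and only if $g$ is surjective. (2) Let $1\to F\xrightarrow{f}G\xrightarrow{g}H\to1$ be a short exact sequence of groups, and let $Bf:BF\to_* BG$ be a delooping of $f$. Then $BF\xrightarrow{Bf}BG\xrightarrow{Bg}BH$ is a fiber sequence, and there is a pointed equivalence $BF\simeq\ker Bg$ under which $Bf$ corresponds to the canonical inclusion. -/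

import Mathlib

open CategoryTheory

universe v u v₁ u₁ v₂ u₂ v₃ u₃ w w₁ w₂ w₃

/-! Types are interpreted as groupoids (1-truncated types): the identity type `x = y` is the set of
arrows `x ⟶ y`, functions are functors, homotopies are natural transformations (automatically
invertible) and equivalences are equivalences of categories. -/

/-- A pointed groupoid, i.e. a pointed 1-type. -/
structure PtGroupoid where
  /-- the underlying type of points -/
  carrier : Type u
  /-- the paths between points -/
  [str : Groupoid.{v} carrier]
  /-- the distinguished point -/
  pt : carrier

namespace PtGroupoid

attribute [instance] PtGroupoid.str

instance : CoeSort PtGroupoid.{v, u} (Type u) := ⟨PtGroupoid.carrier⟩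

/-- The loop space `Ω A` (loops on the distinguished point); since `A` is a groupoid this is a set,
and it is a group for the concatenation of loops, `p * q = p ≫ q`. -/
abbrev Loop (A : PtGroupoid.{v, u}) : Type v := A.pt ⟶ A.pt

/-- The connected component of the distinguished point, as a pointed groupoid. -/
noncomputable def component (A : PtGroupoid.{v, u}) : PtGroupoid.{v, u} :=
  { carrier := ObjectProperty.FullSubcategory (fun x : A.carrier => Nonempty (x ⟶ A.pt))
    str := Groupoid.ofIsIso (fun f => isIso_of_reflects_iso f (ObjectProperty.ι _))
    pt := ⟨A.pt, ⟨𝟙 A.pt⟩⟩ }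

end PtGroupoid

/-- A pointed map: a map together with a path `f pt ⟶ pt`. -/
structure PtMap (A : PtGroupoid.{v₁, u₁}) (B : PtGroupoid.{v₂, u₂}) where
  /-- the underlying map -/
  toFunctor : A ⥤ B
  /-- the path witnessing that the distinguished point is preserved -/
  ptPath : toFunctor.obj A.pt ⟶ B.pt

namespace PtMap

/-- Composition of pointed maps (in diagrammatic order). -/
def comp {A : PtGroupoid.{v₁, u₁}} {B : PtGroupoid.{v₂, u₂}} {C : PtGroupoid.{v₃, u₃}}
    (f : PtMap A B) (g : PtMap B C) : PtMap A C where
  toFunctor := f.toFunctor ⋙ g.toFunctor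
  ptPath := g.toFunctor.map f.ptPath ≫ g.ptPath

/-- The map `Ω f : Ω A → Ω B`, sending `p` to `f_pt⁻¹ · f(p) · f_pt`. -/
def loop {A : PtGroupoid.{v₁, u₁}} {B : PtGroupoid.{v₂, u₂}} (f : PtMap A B) :
    A.Loop →* B.Loop :=
  (Groupoid.vertexGroupIsomOfMap f.ptPath).toMonoidHom.comp (f.toFunctor.mapVertexGroup A.pt)

/-- Two pointed maps are identified when there is a homotopy between them compatible with the
paths on the distinguished point. -/
def Homotopic {A : PtGroupoid.{v₁, u₁}} {B : PtGroupoid.{v₂, u₂}} (f g : PtMap A B) : Prop :=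
  ∃ η : f.toFunctor ≅ g.toFunctor, η.hom.app A.pt ≫ g.ptPath = f.ptPath

/-- The inclusion of the base-point component. -/
noncomputable def componentIncl (A : PtGroupoid.{v, u}) : PtMap A.component A where
  toFunctor := ObjectProperty.ι (fun x : A.carrier => Nonempty (x ⟶ A.pt))
  ptPath := 𝟙 A.pt

/-- The kernel of a pointed map, `ker f = Σ (x : A), f x = pt`: its points are pairs `(x, p)` with
`p : f x ⟶ pt`, its paths `(x, p) ⟶ (y, q)` are the `r : x ⟶ y` with `f r ≫ q = p`, and it is
pointed by `(pt, f_pt)`. -/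
noncomputable def ker {A : PtGroupoid.{v₁, u₁}} {B : PtGroupoid.{v₂, u₂}} (f : PtMap A B) :
    PtGroupoid.{v₁, max u₁ v₂} :=
  { carrier := CostructuredArrow f.toFunctor B.pt
    str := Groupoid.ofIsIso
      (fun r => isIso_of_reflects_iso r (CostructuredArrow.proj f.toFunctor B.pt))
    pt := CostructuredArrow.mk f.ptPath }

/-- The canonical inclusion `ker f → A`, `(x, p) ↦ x`. -/
noncomputable def kerIncl {A : PtGroupoid.{v₁, u₁}} {B : PtGroupoid.{v₂, u₂}} (f : PtMap A B) :
    PtMap f.ker A where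
  toFunctor := CostructuredArrow.proj f.toFunctor B.pt
  ptPath := 𝟙 A.pt

/-- `K = ker f`, with `i : K → A` as canonical inclusion. -/
def IsKernel {K : PtGroupoid.{v, u}} {A : PtGroupoid.{v₁, u₁}} {B : PtGroupoid.{v₂, u₂}}
    (i : PtMap K A) (f : PtMap A B) : Prop :=
  ∃ e : PtMap K f.ker, e.toFunctor.IsEquivalence ∧ (e.comp f.kerIncl).Homotopic i

/-- `K` is the base-point component of `ker f`, with `i : K → A` as canonical inclusion. -/
def IsConnectedKernel {K : PtGroupoid.{v, u}} {A : PtGroupoid.{v₁, u₁}}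
    {B : PtGroupoid.{v₂, u₂}} (i : PtMap K A) (f : PtMap A B) : Prop :=
  ∃ e : PtMap K f.ker.component, e.toFunctor.IsEquivalence ∧
    (e.comp ((componentIncl f.ker).comp f.kerIncl)).Homotopic i

end PtMap

/-- A square commuting up to a homotopy which is a homotopy pullback: the induced map from the
corner `X` to the pullback `Σ (a : A) (c : C), F a = G c` is an equivalence. -/
def IsHomotopyPullback {X : Type u} [Groupoid.{v} X] {A : Type u₁} [Groupoid.{v₁} A]
    {C : Type u₂} [Groupoid.{v₂} C] {B : Type u₃} [Groupoid.{v₃} B]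
    (p : X ⥤ A) (q : X ⥤ C) (F : A ⥤ B) (G : C ⥤ B) : Prop :=
  ∃ h : p ⋙ F ≅ q ⋙ G,
    (Limits.CategoricalPullback.CatCommSqOver.toFunctorToCategoricalPullback F G X |>.obj
      ⟨p, q, h⟩).IsEquivalence

/-- `F → E → B` is a fiber sequence (with `B` pointed by `b`): the map `i` is the pullback of
`b : 1 → B` along `f`. -/
def IsFiberSequence {F : Type u₁} [Groupoid.{v₁} F] {E : Type u₂} [Groupoid.{v₂} E]
    {B : Type u₃} [Groupoid.{v₃} B] (i : F ⥤ E) (f : E ⥤ B) (b : B) : Prop :=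
  IsHomotopyPullback i ((Functor.const F).obj (Discrete.mk PUnit.unit.{1})) f
    (Functor.fromPUnit.{0} b)

/-- A delooping `B G` of a group `G`: a pointed connected groupoid equipped with an identification
of groups `Ω (B G) = G`. -/
structure Delooping (G : Type w) [Group G] extends PtGroupoid.{v, u} where
  /-- there is exactly one connected component -/
  connected : IsConnected carrier
  /-- the identification of the loop group with `G` -/
  loopEquiv : toPtGroupoid.Loop ≃* G

/-- The pointed map `Bf : B G → B H` is the delooping of the group morphism `f`, i.e. `Ω (Bf)` is
the composite `Ω (B G) = G → H = Ω (B H)`. -/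
def IsDeloopingOf {G : Type w₁} [Group G] {H : Type w₂} [Group H]
    {BG : Delooping.{v₁, u₁} G} {BH : Delooping.{v₂, u₂} H}
    (Bf : PtMap BG.toPtGroupoid BH.toPtGroupoid) (f : G →* H) : Prop :=
  Bf.loop = BH.loopEquiv.symm.toMonoidHom.comp (f.comp BG.loopEquiv.toMonoidHom)

namespace PtMap

section

variable {A : PtGroupoid.{v₁, u₁}} {B : PtGroupoid.{v₂, u₂}} {C : PtGroupoid.{v₃, u₃}}

/-! Connected groupoids are controlled by their loop groups, so everything reduces to exactness of
`Ω f` and `Ω g`. If `Ω g ∘ Ω f` is trivial, connectedness gives a pointed nullhomotopy of the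
composite (`exists_nullhomotopy`), hence a lift of `f` to `ker g`. Injectivity of `Ω f` makes the
lift faithful; `range = ker` makes it full (`exists_map_eq`). So it is an equivalence onto the
base-point component, and onto all of `ker g` exactly when `ker g` is connected, that is, when `Ω g`
is surjective. -/

theorem loop_apply (f : PtMap A B) (p : A.Loop) :
    f.loop p = Groupoid.inv f.ptPath ≫ f.toFunctor.map p ≫ f.ptPath := rfl

theorem ptPath_comp_loop (f : PtMap A B) (p : A.Loop) :
    f.ptPath ≫ f.loop p = f.toFunctor.map p ≫ f.ptPath := by
  simp [loop_apply]

theorem loop_comp (f : PtMap A B) (g : PtMap B C) (p : A.Loop) :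
    (f.comp g).loop p = g.loop (f.loop p) := by
  simp [loop_apply, comp]

/-- A pointed map out of a connected groupoid which is trivial on loops is null-homotopic as a
pointed map. -/
theorem exists_nullhomotopy [IsConnected A.carrier] (f : PtMap A B)
    (hf : ∀ p, f.loop p = 𝟙 B.pt) :
    ∃ h : f.toFunctor ≅ (Functor.const A.carrier).obj B.pt, h.hom.app A.pt = f.ptPath := by
  have key (p : A.Loop) : f.toFunctor.map p ≫ f.ptPath = f.ptPath := by
    rw [← ptPath_comp_loop, hf, Category.comp_id]
  have indep {x : A} (p q : x ⟶ A.pt) :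
      f.toFunctor.map p ≫ f.ptPath = f.toFunctor.map q ≫ f.ptPath := by
    simpa [IsIso.inv_comp_eq] using key (inv q ≫ p)
  have path (x : A) : Nonempty (x ⟶ A.pt) := nonempty_hom_of_preconnected_groupoid x A.pt
  refine ⟨NatIso.ofComponents
    (fun x => asIso (f.toFunctor.map (path x).some ≫ f.ptPath)) ?_, ?_⟩
  · intro x y r
    simpa using indep (r ≫ (path y).some) (path x).some
  -- The path chosen at the base point need not be the identity.
  · exact key _

/-- A functor out of a connected groupoid which is injective on the loops at the distinguished
point is faithful. -/
theorem faithful_of_loop_injective [IsConnected A.carrier] (f : PtMap A B)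
    (hf : Function.Injective f.loop) : f.toFunctor.Faithful where
  map_injective {x y r s} hrs := by
    obtain ⟨p⟩ := nonempty_hom_of_preconnected_groupoid A.pt x
    obtain ⟨q⟩ := nonempty_hom_of_preconnected_groupoid y A.pt
    have : p ≫ r ≫ q = p ≫ s ≫ q := hf (by simp [loop_apply, hrs])
    rwa [cancel_epi, cancel_mono] at this

/-- An arrow between images of `f` which is null after `g` lifts along `f`. -/
theorem exists_map_eq [IsConnected A.carrier] (f : PtMap A B) (g : PtMap B C)
    (hfg : f.loop.range = g.loop.ker)
    (h : f.toFunctor ⋙ g.toFunctor ≅ (Functor.const A.carrier).obj C.pt) {x y : A}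
    (r : f.toFunctor.obj x ⟶ f.toFunctor.obj y)
    (hr : g.toFunctor.map r ≫ h.hom.app y = h.hom.app x) :
    ∃ s : x ⟶ y, f.toFunctor.map s = r := by
  obtain ⟨p⟩ := nonempty_hom_of_preconnected_groupoid x A.pt
  obtain ⟨q⟩ := nonempty_hom_of_preconnected_groupoid y A.pt
  have nat {x y : A} (s : x ⟶ y) :
      g.toFunctor.map (f.toFunctor.map s) ≫ h.hom.app y = h.hom.app x := by
    simpa using h.hom.naturality s
  -- Conjugation turns `r` into a loop, where exactness applies.
  let m : f.toFunctor.obj A.pt ⟶ f.toFunctor.obj A.pt :=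
    inv (f.toFunctor.map p) ≫ r ≫ f.toFunctor.map q
  have hm : g.toFunctor.map m = 𝟙 _ := by
    rw [← cancel_mono (h.hom.app A.pt)]
    simp only [m, Functor.map_comp, Functor.map_inv, Category.assoc, nat, hr, Category.id_comp,
      IsIso.inv_comp_eq]
  have hker : (inv f.ptPath ≫ m ≫ f.ptPath : B.Loop) ∈ g.loop.ker := by
    rw [MonoidHom.mem_ker]
    simp [loop_apply, hm]
  obtain ⟨k, hk⟩ := hfg ▸ hker
  have hk' : f.toFunctor.map k = m := by
    rw [← cancel_mono f.ptPath, ← cancel_epi (Groupoid.inv f.ptPath)]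
    simpa [loop_apply] using hk
  exact ⟨p ≫ k ≫ inv q, by simp [hk', m]⟩

/-- The map into the kernel of `g` induced by a pointed nullhomotopy of `f.comp g`. -/
noncomputable def kerLift (f : PtMap A B) (g : PtMap B C)
    (h : f.toFunctor ⋙ g.toFunctor ≅ (Functor.const A.carrier).obj C.pt)
    (hpt : h.hom.app A.pt = (f.comp g).ptPath) : PtMap A g.ker where
  toFunctor :=
    { obj x := CostructuredArrow.mk (Y := f.toFunctor.obj x) (h.hom.app x)
      map s := CostructuredArrow.homMk (f.toFunctor.map s) (by simpa using h.hom.naturality s)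
      map_id x := CostructuredArrow.hom_ext _ _ (f.toFunctor.map_id x)
      map_comp r s := CostructuredArrow.hom_ext _ _ (f.toFunctor.map_comp r s) }
  ptPath := CostructuredArrow.homMk f.ptPath hpt.symm

theorem kerLift_comp_kerIncl (f : PtMap A B) (g : PtMap B C)
    (h : f.toFunctor ⋙ g.toFunctor ≅ (Functor.const A.carrier).obj C.pt)
    (hpt : h.hom.app A.pt = (f.comp g).ptPath) :
    ((kerLift f g h hpt).comp g.kerIncl).Homotopic f :=
  ⟨Iso.refl _, (Category.id_comp _).trans (Category.comp_id _).symm⟩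

theorem kerLift_faithful [IsConnected A.carrier] (f : PtMap A B) (g : PtMap B C)
    (hf : Function.Injective f.loop)
    (h : f.toFunctor ⋙ g.toFunctor ≅ (Functor.const A.carrier).obj C.pt)
    (hpt : h.hom.app A.pt = (f.comp g).ptPath) : (kerLift f g h hpt).toFunctor.Faithful where
  map_injective hrs :=
    (f.faithful_of_loop_injective hf).map_injective (congrArg CommaMorphism.left hrs)

theorem kerLift_full [IsConnected A.carrier] (f : PtMap A B) (g : PtMap B C)
    (hfg : f.loop.range = g.loop.ker)
    (h : f.toFunctor ⋙ g.toFunctor ≅ (Functor.const A.carrier).obj C.pt)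
    (hpt : h.hom.app A.pt = (f.comp g).ptPath) : (kerLift f g h hpt).toFunctor.Full where
  map_surjective {x y} r := by
    obtain ⟨s, hs⟩ := f.exists_map_eq g hfg h r.left (CostructuredArrow.w r)
    exact ⟨s, CostructuredArrow.hom_ext _ _ hs⟩

/-! ### Connectedness of the kernel -/

/-- If `g` is surjective on loops then every point of its kernel is connected to the
distinguished one. -/
theorem nonempty_hom_ker_pt [IsConnected B.carrier] (g : PtMap B C)
    (hg : Function.Surjective g.loop) (y : g.ker) : Nonempty (y ⟶ g.ker.pt) := by
  change CostructuredArrow g.toFunctor C.pt at y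
  obtain ⟨q⟩ := nonempty_hom_of_preconnected_groupoid y.left B.pt
  -- The loop corrects the discrepancy between the path induced by `q` and the given `y.hom`.
  obtain ⟨l, hl⟩ := hg (inv (g.toFunctor.map q ≫ g.ptPath) ≫ y.hom)
  refine ⟨CostructuredArrow.homMk (q ≫ l) ?_⟩
  change g.toFunctor.map (q ≫ l) ≫ g.ptPath = y.hom
  rw [Functor.map_comp, Category.assoc, ← ptPath_comp_loop, hl]
  simp

/-- If the kernel of `g` is connected then `g` is surjective on loops. -/
theorem loop_surjective_of_ker_connected (g : PtMap B C)
    (hg : ∀ y : g.ker, Nonempty (y ⟶ g.ker.pt)) : Function.Surjective g.loop := by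
  intro l
  -- An arrow from the base point twisted by `l` is precisely a preimage of `l` under `Ω g`.
  obtain ⟨r⟩ := hg (CostructuredArrow.mk (Y := B.pt) (g.ptPath ≫ l))
  have hr : g.toFunctor.map r.left ≫ g.ptPath = g.ptPath ≫ l := CostructuredArrow.w r
  let q : B.pt ⟶ B.pt := r.left
  exact ⟨q, (cancel_epi g.ptPath).1 ((g.ptPath_comp_loop q).trans hr)⟩

theorem nonempty_hom_of_isEquivalence [IsConnected A.carrier] (e : PtMap A B)
    [e.toFunctor.IsEquivalence] (y : B) : Nonempty (y ⟶ B.pt) := by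
  obtain ⟨p⟩ := nonempty_hom_of_preconnected_groupoid (e.toFunctor.objPreimage y) A.pt
  exact ⟨(e.toFunctor.objObjPreimageIso y).inv ≫ e.toFunctor.map p ≫ e.ptPath⟩

theorem essSurj_of_nonempty_hom (e : PtMap A B) (hB : ∀ y : B, Nonempty (y ⟶ B.pt)) :
    e.toFunctor.EssSurj where
  mem_essImage y := by
    obtain ⟨p⟩ := hB y
    exact ⟨A.pt, ⟨asIso (e.ptPath ≫ inv p)⟩⟩

/-- A pointed map out of a connected groupoid factors through the base-point component. -/
noncomputable def componentLift [IsConnected A.carrier] (e : PtMap A B) :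
    PtMap A B.component where
  toFunctor := ObjectProperty.lift _ e.toFunctor fun x =>
    (nonempty_hom_of_preconnected_groupoid x A.pt).map fun p => e.toFunctor.map p ≫ e.ptPath
  ptPath := ObjectProperty.homMk e.ptPath

theorem nonempty_hom_component_pt (y : B.component) : Nonempty (y ⟶ B.component.pt) :=
  y.property.map fun p => ObjectProperty.homMk p

theorem componentLift_isEquivalence [IsConnected A.carrier] (e : PtMap A B)
    [e.toFunctor.Full] [e.toFunctor.Faithful] : e.componentLift.toFunctor.IsEquivalence :=
  { faithful := inferInstanceAs (ObjectProperty.lift _ e.toFunctor _).Faithful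
    full := inferInstanceAs (ObjectProperty.lift _ e.toFunctor _).Full
    essSurj := essSurj_of_nonempty_hom _ nonempty_hom_component_pt }

/-! ### Kernels and fiber sequences from exactness on loops -/

theorem exists_ker_nullhomotopy [IsConnected A.carrier] (f : PtMap A B) (g : PtMap B C)
    (hfg : f.loop.range = g.loop.ker) :
    ∃ h : f.toFunctor ⋙ g.toFunctor ≅ (Functor.const A.carrier).obj C.pt,
      h.hom.app A.pt = (f.comp g).ptPath :=
  (f.comp g).exists_nullhomotopy fun p => by
    rw [loop_comp]
    exact MonoidHom.mem_ker.1 (hfg ▸ ⟨p, rfl⟩)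

theorem isConnectedKernel_of_loop [IsConnected A.carrier] (f : PtMap A B) (g : PtMap B C)
    (hf : Function.Injective f.loop) (hfg : f.loop.range = g.loop.ker) :
    f.IsConnectedKernel g := by
  obtain ⟨h, hpt⟩ := exists_ker_nullhomotopy f g hfg
  have := kerLift_faithful f g hf h hpt
  have := kerLift_full f g hfg h hpt
  refine ⟨(kerLift f g h hpt).componentLift, componentLift_isEquivalence _, Iso.refl _, ?_⟩
  change 𝟙 _ ≫ f.ptPath = f.ptPath ≫ 𝟙 _ ≫ 𝟙 _
  simp

theorem isKernel_of_loop [IsConnected A.carrier] [IsConnected B.carrier] (f : PtMap A B)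
    (g : PtMap B C) (hf : Function.Injective f.loop) (hfg : f.loop.range = g.loop.ker)
    (hg : Function.Surjective g.loop) : f.IsKernel g := by
  obtain ⟨h, hpt⟩ := exists_ker_nullhomotopy f g hfg
  exact ⟨kerLift f g h hpt,
    { faithful := kerLift_faithful f g hf h hpt
      full := kerLift_full f g hfg h hpt
      essSurj := essSurj_of_nonempty_hom _ (g.nonempty_hom_ker_pt hg) },
    kerLift_comp_kerIncl f g h hpt⟩

theorem IsKernel.loop_surjective [IsConnected A.carrier] {f : PtMap A B} {g : PtMap B C}
    (hfg : f.IsKernel g) : Function.Surjective g.loop := by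
  obtain ⟨e, he, -⟩ := hfg
  exact g.loop_surjective_of_ker_connected e.nonempty_hom_of_isEquivalence

theorem isFiberSequence_of_loop [IsConnected A.carrier] [IsConnected B.carrier] (f : PtMap A B)
    (g : PtMap B C) (hf : Function.Injective f.loop) (hfg : f.loop.range = g.loop.ker)
    (hg : Function.Surjective g.loop) : IsFiberSequence f.toFunctor g.toFunctor C.pt := by
  obtain ⟨h, hpt⟩ := exists_ker_nullhomotopy f g hfg
  -- The two constant functors agree on objects, so identity components suffice.
  refine ⟨h ≪≫ NatIso.ofComponents (fun _ => Iso.refl _) (by intros; rfl),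
    { faithful := ⟨fun hrs => ?_⟩, full := ⟨fun {x y} r => ?_⟩, essSurj := ⟨fun y => ?_⟩ }⟩
  · exact (f.faithful_of_loop_injective hf).map_injective
      (congrArg Limits.CategoricalPullback.Hom.fst hrs)
  · obtain ⟨s, hs⟩ := f.exists_map_eq g hfg h r.fst
      ((congrArg (g.toFunctor.map r.fst ≫ ·) (Category.comp_id _).symm).trans
        ((r.w.trans (Category.comp_id _)).trans (Category.comp_id _)))
    exact ⟨s, Limits.CategoricalPullback.hom_ext hs (Subsingleton.elim _ _)⟩
  -- Over the one-point groupoid, a point of the pullback is a point of `ker g`.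
  · obtain ⟨p⟩ := g.nonempty_hom_ker_pt hg (CostructuredArrow.mk (Y := y.fst) y.iso.hom)
    let q : y.fst ⟶ B.pt := p.left
    have hq : g.toFunctor.map q ≫ g.ptPath = y.iso.hom := CostructuredArrow.w p
    have hfq : g.toFunctor.map (f.ptPath ≫ inv q) ≫ g.toFunctor.map q ≫ g.ptPath =
        g.toFunctor.map f.ptPath ≫ g.ptPath := by
      simp
    refine ⟨A.pt, ⟨Limits.CategoricalPullback.mkIso
      (asIso (f.ptPath ≫ inv q)) (eqToIso (Subsingleton.elim _ _)) ?_⟩⟩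
    have hA : h.hom.app A.pt = g.toFunctor.map f.ptPath ≫ g.ptPath := hpt
    rw [← hA, hq] at hfq
    exact hfq.trans ((Category.comp_id _).symm.trans (Category.comp_id _).symm)

end

end PtMap

/-! ### Transfer between group morphisms and maps on loops -/

namespace IsDeloopingOf

variable {G : Type w₁} [Group G] {H : Type w₂} [Group H]
  {BG : Delooping.{v₁, u₁} G} {BH : Delooping.{v₂, u₂} H}
  {Bf : PtMap BG.toPtGroupoid BH.toPtGroupoid} {f : G →* H}

theorem loopEquiv_loop (h : IsDeloopingOf Bf f) (p : BG.Loop) :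
    BH.loopEquiv (Bf.loop p) = f (BG.loopEquiv p) := by
  have h' : Bf.loop = BH.loopEquiv.symm.toMonoidHom.comp (f.comp BG.loopEquiv.toMonoidHom) := h
  simp [h']

theorem loop_injective_iff (h : IsDeloopingOf Bf f) :
    Function.Injective Bf.loop ↔ Function.Injective f := by
  rw [← BH.loopEquiv.injective.of_comp_iff, ← Function.Injective.of_comp_iff' f BG.loopEquiv.bijective]
  exact iff_of_eq (congrArg _ (funext h.loopEquiv_loop))

theorem loop_surjective_iff (h : IsDeloopingOf Bf f) :
    Function.Surjective Bf.loop ↔ Function.Surjective f := by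
  rw [← BG.loopEquiv.surjective.of_comp_iff, ← Function.Surjective.of_comp_iff'
    BH.loopEquiv.bijective]
  exact iff_of_eq (congrArg _ (funext h.loopEquiv_loop))

theorem mem_ker_loop (h : IsDeloopingOf Bf f) (p : BG.Loop) :
    p ∈ Bf.loop.ker ↔ BG.loopEquiv p ∈ f.ker := by
  rw [MonoidHom.mem_ker, MonoidHom.mem_ker, ← h.loopEquiv_loop, map_eq_one_iff _
    BH.loopEquiv.injective]

theorem mem_range_loop (h : IsDeloopingOf Bf f) (q : BH.Loop) :
    q ∈ Bf.loop.range ↔ BH.loopEquiv q ∈ f.range := by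
  constructor
  · rintro ⟨p, rfl⟩
    exact ⟨BG.loopEquiv p, (h.loopEquiv_loop p).symm⟩
  · rintro ⟨x, hx⟩
    refine ⟨BG.loopEquiv.symm x, BH.loopEquiv.injective ?_⟩
    rw [h.loopEquiv_loop, MulEquiv.apply_symm_apply, hx]

theorem range_loop_eq_ker_loop {K : Type w₃} [Group K] {BK : Delooping.{v₃, u₃} K}
    {Bg : PtMap BH.toPtGroupoid BK.toPtGroupoid} {g : H →* K} (hf : IsDeloopingOf Bf f)
    (hg : IsDeloopingOf Bg g) (hfg : f.range = g.ker) : Bf.loop.range = Bg.loop.ker := by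
  ext q
  rw [hf.mem_range_loop, hg.mem_ker_loop, hfg]

end IsDeloopingOf

theorem mainTheorem10 {G : Type w₁} [Group G] {H : Type w₂} [Group H] (g : G →* H)
    (BG : Delooping.{v₁, u₁} G) (BH : Delooping.{v₂, u₂} H)
    (Bg : PtMap BG.toPtGroupoid BH.toPtGroupoid) (hBg : IsDeloopingOf Bg g) :
    (∀ (BK : Delooping.{v₃, u₃} g.ker) (Bi : PtMap BK.toPtGroupoid BG.toPtGroupoid),
      IsDeloopingOf Bi g.ker.subtype →
        Bi.IsConnectedKernel Bg ∧ (Bi.IsKernel Bg ↔ Function.Surjective g)) ∧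
    (∀ (F : Type w) [Group F] (f : F →* G) (BF : Delooping.{v, u} F)
      (Bf : PtMap BF.toPtGroupoid BG.toPtGroupoid), IsDeloopingOf Bf f →
        Function.Injective f → f.range = g.ker → Function.Surjective g →
          IsFiberSequence Bf.toFunctor Bg.toFunctor BH.pt ∧ Bf.IsKernel Bg) := by
  have := BG.connected
  refine ⟨fun BK Bi hBi => ?_, fun F _ f BF Bf hBf hf hfg hg => ?_⟩
  · have := BK.connected
    have hinj := hBi.loop_injective_iff.2 g.ker.subtype_injective
    have hex := hBi.range_loop_eq_ker_loop hBg g.ker.range_subtype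
    exact ⟨Bi.isConnectedKernel_of_loop Bg hinj hex,
      fun hK => hBg.loop_surjective_iff.1 hK.loop_surjective,
      fun hg => Bi.isKernel_of_loop Bg hinj hex (hBg.loop_surjective_iff.2 hg)⟩
  · have := BF.connected
    have hinj := hBf.loop_injective_iff.2 hf
    have hex := hBf.range_loop_eq_ker_loop hBg hfg
    have hsurj := hBg.loop_surjective_iff.2 hg
    exact ⟨Bf.isFiberSequence_of_loop Bg hinj hex hsurj, Bf.isKernel_of_loop Bg hinj hex hsurj⟩
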